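/- Let $p$ be a prime with $p \equiv 7 \pmod{12}$ and let $\overline{\mathbb{F}_p}$ be an algebraic closure of $\mathbb{F}_p$. For each $\lambda \in \mathbb{F}_p$ choose a square root $\sqrt{\lambda^2-\lambda+1} \in \overline{\mathbb{F}_p}$ of $\lambda^2-\lambda+1$, put $$\Lambda^{\pm}(\lambda) = (1-\lambda)\left(\lambda \pm \sqrt{\lambda^2-\lambda+1}\right)^2 \in \overline{\mathbb{F}_p},$$ and let $E_{\Lambda^{\pm}(\lambda)}$ be the curve over $\overline{\mathbb{F}_p}$ given by $$Y^2 = X(X-1)\left(X-\Lambda^{\pm}(\lambda)\right).$$ Then, for any choice of the square roots, there is no $\lambda \in \mathbb{F}_p$ such that $E_{\Lambda^-(\lambda)}$ and $E_{\Lambda^+(\lambda)}$ are both supersingular elliptic curves, that is, are both nonsingular with no nontrivial $p$-torsion point over $\overline{\mathbb{F}_p}$. -/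

import Mathlib

/-- The Legendre curve `Y² = X (X - 1) (X - t)`, i.e. `Y² = X³ - (1 + t) X² + t X`. -/
def legendreCurve {K : Type*} [Field K] (t : K) : WeierstrassCurve K where
  a₁ := 0
  a₂ := -(1 + t)
  a₃ := 0
  a₄ := t
  a₆ := 0

theorem legendreCurve_equation_iff {K : Type*} [Field K] (t x y : K) :
    (legendreCurve t).toAffine.Equation x y ↔ y ^ 2 = x * (x - 1) * (x - t) := by
  rw [WeierstrassCurve.Affine.equation_iff]
  simp only [legendreCurve]
  constructor <;> intro h <;> linear_combination h

open Classical in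
/-- A Weierstrass curve over an algebraically closed field of characteristic `p` is a supersingular
elliptic curve if it is nonsingular (invertible discriminant) and its group of points has no
nontrivial `p`-torsion. -/
def IsSupersingular (p : ℕ) {K : Type*} [Field K] [IsAlgClosed K] [CharP K p]
    (E : WeierstrassCurve K) : Prop :=
  E.IsElliptic ∧ ∀ P : E.toAffine.Point, p • P = 0 → P = 0

/-- `Λ⁻(l) = (1 - l) (l - s)²`, where `s` is the chosen square root of `l² - l + 1`. -/
def LambdaMinus {K : Type*} [Field K] (l s : K) : K := (1 - l) * (l - s) ^ 2

/-- `Λ⁺(l) = (1 - l) (l + s)²`, where `s` is the chosen square root of `l² - l + 1`. -/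
def LambdaPlus {K : Type*} [Field K] (l s : K) : K := (1 - l) * (l + s) ^ 2

/-! The curve for `Λ⁺` alone is never supersingular; as `s` may be either square root, this covers
both signs.

On an elliptic curve without `p`-torsion, `[p]` acts on `x`-coordinates by `x ↦ (x ^ p ^ 2 - a) / b`
(`exists_xRep_prime_smul`). For a Legendre curve, the fixed points `(0, 0)` and `(1, 0)` force `a =
0`, `b = 1`. The curve of parameter `Λ⁺` has a point `P` of order 3 and a point `Q` of order 4 with
coordinates in the field `F` of `p ^ 2` elements. Since `p ≡ 1 [MOD 3]` and `p ≡ 3 [MOD 4]`, `p • (P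
+ Q) = P - Q`, while `x(P + Q) ∈ F` is fixed by the `p ^ 2`-power map. So `P - Q = ±(P + Q)`, giving
`2 • Q = 0` or `2 • P = 0`, a contradiction (`legendreCurve_false_of_torsion`).

The shape of `[p]` comes from coprime polynomials `A`, `B` with `x(n • P) = A(x) / B(x)`, built by
recursion from the formula relating `x(P ± Q)` to `x(P)`, `x(Q)`. -/

open Polynomial

/-! ### Sums and differences of points on `x`-coordinates -/

namespace WeierstrassCurve.Affine.Point

variable {K : Type*} [Field K] [DecidableEq K] {W : WeierstrassCurve K}

/-- The addition-and-subtraction map is compatible with the group law: it sends the symmetric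
square of the `x`-coordinates of `P` and `Q` to that of `P + Q` and `P - Q`. -/
theorem exists_addSubMap_sym2x [W.IsElliptic] (P Q : W.toAffine.Point) :
    ∃ c : K, c ≠ 0 ∧ (fun i ↦ (W.addSubMap i).eval (P.sym2x Q)) = c • (P + Q).sym2x (P - Q) := by
  match P, Q with
  | 0, 0 =>
    refine ⟨1, one_ne_zero, ?_⟩
    ext i
    fin_cases i <;> simp [addSubMap]
  | 0, some x y h =>
    refine ⟨1, one_ne_zero, ?_⟩
    rw [zero_add, zero_sub, sym2x_neg_right]
    ext i
    fin_cases i <;> simp [addSubMap] <;> ring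
  | some x y h, 0 =>
    refine ⟨1, one_ne_zero, ?_⟩
    rw [add_zero, sub_zero]
    ext i
    fin_cases i <;> simp [addSubMap] <;> ring
  | some x₁ y₁ h₁, some x₂ y₂ h₂ =>
    by_cases hx : x₁ = x₂
    -- Equal `x`-coordinates mean `P = ±Q`; both signs reduce to doubling, as the symmetric square
    -- ignores order and signs.
    · have key : ∀ {x y : K} (h : W.toAffine.Nonsingular x y), ∃ c : K, c ≠ 0 ∧
          (fun i ↦ (W.addSubMap i).eval ![x * x, x + x, 1]) =
            c • (some x y h + some x y h).sym2x 0 := by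
        intro x y h
        have heq := (W.toAffine.equation_iff x y).mp h.left
        by_cases hy : y = W.toAffine.negY x y
        · rw [add_self_of_Y_eq hy]
          have hne := W.addSubMap_ne_zero (x := ![x * x, x + x, 1])
            (fun h0 ↦ by simpa using congrFun h0 2)
          have h1 : (W.addSubMap 1).eval ![x * x, x + x, 1] = 0 := by
            rw [negY] at hy
            simp [addSubMap, b₂, b₄, b₆]
            linear_combination (-4 : K) * heq + (2 * y + W.a₁ * x + W.a₃) * hy
          have h2 : (W.addSubMap 2).eval ![x * x, x + x, 1] = 0 := by
            simp [addSubMap]; ring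
          -- The double is the point at infinity, so only the first coordinate survives; it is
          -- nonzero because the whole vector is.
          refine ⟨(W.addSubMap 0).eval ![x * x, x + x, 1], fun h0 ↦ hne ?_, ?_⟩
          · ext i; fin_cases i
            · exact h0
            · exact h1
            · exact h2
          · ext i; fin_cases i
            · simp
            · simpa using h1
            · simpa using h2
        · have hd : y - W.toAffine.negY x y ≠ 0 := sub_ne_zero.mpr hy
          -- The denominator of the duplication formula.
          refine ⟨(y - W.toAffine.negY x y) ^ 2, pow_ne_zero 2 hd, ?_⟩
          rw [add_self_of_Y_ne hy, sym2x_some_zero]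
          have hs := slope_of_Y_ne (W := W.toAffine) (rfl : x = x) hy
          generalize W.toAffine.slope x x y y = ℓ at hs
          have hl : ℓ * (y - W.toAffine.negY x y) =
              3 * x ^ 2 + 2 * W.a₂ * x + W.a₄ - W.a₁ * y := by
            rw [hs, div_mul_cancel₀ _ hd]
          rw [negY] at hl
          ext i; fin_cases i
          · simp [addSubMap, addX, negY, b₂, b₄, b₆, b₈]
            linear_combination (-(ℓ * (2 * y + W.a₁ * x + W.a₃) + (3 * x ^ 2 + 2 * W.a₂ * x + W.a₄
              - W.a₁ * y) + W.a₁ * (2 * y + W.a₁ * x + W.a₃))) * hl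
              + (W.a₁ ^ 2 + 4 * (W.a₂ + 2 * x)) * heq
          · simp [addSubMap, negY, b₂, b₄, b₆, b₈]
            linear_combination (-4 : K) * heq
          · simp [addSubMap]; ring
      rcases X_eq_iff.mp hx with h | h
      · rw [h, sub_self, sym2x_some_some]
        exact key h₂
      · rw [h, neg_add_cancel, ← neg_add', sym2x_neg_left, sym2x_neg_right, sym2x_some_some,
          sym2x_comm]
        exact key h₂
    · have hd : x₁ - x₂ ≠ 0 := sub_ne_zero.mpr hx
      -- The common denominator of `x(P + Q)` and `x(P - Q)`.
      refine ⟨(x₁ - x₂) ^ 2, pow_ne_zero 2 hd, ?_⟩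
      have e₁ := (W.toAffine.equation_iff x₁ y₁).mp h₁.left
      have e₂ := (W.toAffine.equation_iff x₂ y₂).mp h₂.left
      rw [sub_eq_add_neg (some x₁ y₁ h₁), neg_some, add_of_X_ne hx, add_of_X_ne hx, sym2x_some_some,
        sym2x_some_some]
      have hp := slope_of_X_ne (W := W.toAffine) (y₁ := y₁) (y₂ := y₂) hx
      have hq := slope_of_X_ne (W := W.toAffine) (y₁ := y₁) (y₂ := W.toAffine.negY x₂ y₂) hx
      generalize W.toAffine.slope x₁ x₂ y₁ y₂ = ℓ at hp
      generalize W.toAffine.slope x₁ x₂ y₁ (W.toAffine.negY x₂ y₂) = m at hq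
      rw [eq_div_iff hd] at hp hq
      rw [negY] at hq
      set k := W.a₂ + x₁ + x₂ with hk
      set f₁ := W.a₁ * x₁ + W.a₃ with hf₁
      set f₂ := W.a₁ * x₂ + W.a₃ with hf₂
      set g₁ := x₁ ^ 3 + W.a₂ * x₁ ^ 2 + W.a₄ * x₁ + W.a₆ with hg₁
      set g₂ := x₂ ^ 3 + W.a₂ * x₂ ^ 2 + W.a₄ * x₂ + W.a₆ with hg₂
      have hA : (x₁ - x₂) ^ 2 * W.toAffine.addX x₁ x₂ ℓ =
          (y₁ - y₂) * (y₁ - y₂ + W.a₁ * (x₁ - x₂)) - k * (x₁ - x₂) ^ 2 := by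
        rw [addX]
        linear_combination (ℓ * (x₁ - x₂) + (y₁ - y₂) + W.a₁ * (x₁ - x₂)) * hp
      have hB : (x₁ - x₂) ^ 2 * W.toAffine.addX x₁ x₂ m =
          (y₁ + y₂ + f₂) * (y₁ + y₂ + f₂ + W.a₁ * (x₁ - x₂)) - k * (x₁ - x₂) ^ 2 := by
        rw [addX]
        linear_combination (m * (x₁ - x₂) + (y₁ + y₂ + f₂) + W.a₁ * (x₁ - x₂)) * hq
      generalize W.toAffine.addX x₁ x₂ ℓ = X₁ at hA ⊢
      generalize W.toAffine.addX x₁ x₂ m = X₂ at hB ⊢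
      ext i; fin_cases i
      · simp [addSubMap, b₂, b₄, b₆, b₈]
        apply mul_left_cancel₀ (pow_ne_zero 2 hd)
        have : (x₁ - x₂) ^ 2 * ((x₁ - x₂) ^ 2 *
            (X₁ * X₂)) =
            ((x₁ - x₂) ^ 2 * X₁) *
              ((x₁ - x₂) ^ 2 * X₂) := by ring
        rw [this, hA, hB]
        have e₁' : y₁ ^ 2 + f₁ * y₁ - g₁ = 0 := by rw [hf₁]; linear_combination e₁
        have e₂' : y₂ ^ 2 + f₂ * y₂ - g₂ = 0 := by rw [hf₂]; linear_combination e₂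
        linear_combination (-(y₁ ^ 2 + f₁ * y₁ + g₁ - 2 * (y₂ ^ 2 + f₂ * y₂) - f₂ ^ 2 + f₁ * f₂
          - 2 * k * (x₁ - x₂) ^ 2)) * e₁' - ((y₂ ^ 2 + f₂ * y₂) + g₂ - 2 * g₁ + f₁ * f₂ - f₁ ^ 2
          - 2 * k * (x₁ - x₂) ^ 2) * e₂'
      · simp [addSubMap, b₂, b₄, b₆, b₈]
        linear_combination (-2 : K) * e₁ - 2 * e₂ - hA - hB
      · simp [addSubMap]; ring

end WeierstrassCurve.Affine.Point

/-! ### Factoring binary quadratic forms -/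

namespace Polynomial

/-- A binary quadratic form with polynomial coefficients that vanishes at a coprime pair `(C, D)`
splits off the corresponding linear factor. -/
theorem exists_linear_factor_of_isCoprime {K : Type*} [Field K] {C D S T U : K[X]} (hC : C ≠ 0)
    (h : IsCoprime C D) (h0 : U * C ^ 2 - T * C * D + S * D ^ 2 = 0) :
    ∃ E F, S = C * E ∧ T = C * F + D * E ∧ U = D * F := by
  by_cases hD : D = 0
  · subst hD
    obtain ⟨C', hC'⟩ := isCoprime_zero_right.mp h |>.exists_right_inv
    have hU : U = 0 := by
      have : U * C ^ 2 = 0 := by linear_combination h0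
      exact (mul_eq_zero.mp this).resolve_right (pow_ne_zero 2 hC)
    exact ⟨S * C', T * C', by linear_combination -S * hC', by linear_combination -T * hC',
      by rw [hU, zero_mul]⟩
  · have hDU : D ∣ U := (h.symm.pow_right (n := 2)).dvd_of_dvd_mul_right
      ⟨T * C - S * D, by linear_combination h0⟩
    have hCS : C ∣ S := (h.pow_right (n := 2)).dvd_of_dvd_mul_right
      ⟨T * D - U * C, by linear_combination h0⟩
    obtain ⟨F, rfl⟩ := hDU
    obtain ⟨E, rfl⟩ := hCS
    refine ⟨E, F, rfl, ?_, rfl⟩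
    apply mul_left_cancel₀ (mul_ne_zero hC hD)
    linear_combination -h0

end Polynomial

/-! ### Multiplication by `n` on `x`-coordinates -/

namespace WeierstrassCurve

variable {K : Type*} [Field K] (W : WeierstrassCurve K)

/-- The coprime polynomials `A` and `B` express the `x`-coordinate of `n • P` in terms of that
of `P`, with `A` monic of degree `n ^ 2` and `B` of smaller degree. -/
structure IsMulByX [DecidableEq K] (n : ℕ) (A B : K[X]) : Prop where
  monic : A.Monic
  natDegree : A.natDegree = n ^ 2
  degree_lt : B.degree < (n ^ 2 : ℕ)
  coprime : IsCoprime A B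
  exists_xRep : ∀ {x y : K} (h : W.toAffine.Nonsingular x y), ∃ c : K, c ≠ 0 ∧
    (n • Affine.Point.some x y h).xRep = c • ![A.eval x, B.eval x]

/-- Lets polynomial statements in `x` be checked on points of the curve. -/
theorem exists_nonsingular [IsAlgClosed K] [W.IsElliptic] (x : K) :
    ∃ y, W.toAffine.Nonsingular x y := by
  obtain ⟨y, hy⟩ := IsAlgClosed.exists_root
    (X ^ 2 + (C (W.a₁ * x + W.a₃) * X - C (x ^ 3 + W.a₂ * x ^ 2 + W.a₄ * x + W.a₆)))
    (by
      rw [degree_add_eq_left_of_degree_lt]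
      · simp
      · rw [degree_X_pow]
        refine (degree_sub_le _ _).trans_lt (max_lt ?_ ?_)
        · exact (degree_C_mul_X_le _).trans_lt (by norm_num)
        · exact degree_C_le.trans_lt (by norm_num))
  refine ⟨y, (Affine.equation_iff_nonsingular).mp ((W.toAffine.equation_iff x y).mpr ?_)⟩
  simp [IsRoot] at hy
  linear_combination hy

variable [DecidableEq K]

theorem isMulByX_zero : W.IsMulByX 0 1 0 where
  monic := monic_one
  natDegree := by simp
  degree_lt := by simp
  coprime := isCoprime_one_left
  exists_xRep h := ⟨1, one_ne_zero, by simp⟩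

theorem isMulByX_one : W.IsMulByX 1 X 1 where
  monic := monic_X
  natDegree := by simp
  degree_lt := by simp
  coprime := isCoprime_one_right
  exists_xRep h := ⟨1, one_ne_zero, by simp⟩

variable {W}

/-- Applied to `(n + 1) • P` and `P`, the addition-and-subtraction map gives the symmetric product
of `x((n + 2) • P)` and `x(n • P)`. The known factor `(C : D)` is then split off. -/
theorem IsMulByX.step [IsAlgClosed K] [W.IsElliptic] {n : ℕ} {C D A B : K[X]}
    (h₀ : W.IsMulByX n C D) (h₁ : W.IsMulByX (n + 1) A B) :
    ∃ E F, W.IsMulByX (n + 2) E F := by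
  -- `S`, `T`, `U` are the components of `addSubMap` at the symmetric product of `(A : B)` and `(X :
  -- 1)`.
  set S : K[X] := (A * X) ^ 2 - (Polynomial.C W.b₄ * (A * X) * B
    + Polynomial.C W.b₆ * (A + B * X) * B + Polynomial.C W.b₈ * B ^ 2) with hS
  set T : K[X] := Polynomial.C 2 * (A + B * X) * (A * X) + Polynomial.C W.b₂ * (A * X) * B
    + Polynomial.C W.b₄ * (A + B * X) * B + Polynomial.C W.b₆ * B ^ 2 with hT
  set U : K[X] := (A + B * X) ^ 2 - Polynomial.C 4 * (A * X) * B with hU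
  -- the pointwise form of the factorisation
  have key : ∀ {x y : K} (h : W.toAffine.Nonsingular x y), ∃ k e f : K, k ≠ 0 ∧
      ((n + 2) • Affine.Point.some x y h).xRep = ![e, f] ∧
      S.eval x = k * (C.eval x * e) ∧
      T.eval x = k * (C.eval x * f + D.eval x * e) ∧
      U.eval x = k * (D.eval x * f) := by
    intro x y h
    obtain ⟨a, ha, hA⟩ := h₁.exists_xRep h
    obtain ⟨b, hb, hC⟩ := h₀.exists_xRep h
    set P := Affine.Point.some x y h with hP
    obtain ⟨c, hc, hadd⟩ := Affine.Point.exists_addSubMap_sym2x ((n + 1) • P) P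
    have e₁ : (n + 1) • P + P = (n + 2) • P := by rw [← succ_nsmul]
    have e₂ : (n + 1) • P - P = n • P := by rw [succ_nsmul, add_sub_cancel_right]
    rw [e₁, e₂] at hadd
    have hPx : P.xRep = ![x, 1] := by rw [hP, Affine.Point.xRep_some]
    -- The components are quadratic in `(A, B)`, whence `a ^ 2`; `b` rescales `(C, D)`.
    refine ⟨c * b / a ^ 2, ((n + 2) • P).xRep 0, ((n + 2) • P).xRep 1, by positivity, ?_, ?_⟩
    · ext i; fin_cases i <;> rfl
    have s0 := congrFun hadd 0
    have s1 := congrFun hadd 1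
    have s2 := congrFun hadd 2
    simp [Affine.Point.sym2x, hA, hC, hPx, addSubMap] at s0 s1 s2
    generalize ((n + 2) • P).xRep 0 = e at *
    generalize ((n + 2) • P).xRep 1 = f at *
    have ha2 : a ^ 2 ≠ 0 := pow_ne_zero 2 ha
    refine ⟨?_, ?_, ?_⟩ <;> rw [div_mul_eq_mul_div, eq_div_iff ha2]
    · rw [hS]; simp; linear_combination s0
    · rw [hT]; simp; linear_combination s1
    · rw [hU]; simp; linear_combination s2
  have hform : U * C ^ 2 - T * C * D + S * D ^ 2 = 0 := by
    refine Polynomial.funext fun x ↦ ?_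
    obtain ⟨y, h⟩ := W.exists_nonsingular x
    obtain ⟨k, e, f, -, -, hs, ht, hu⟩ := key h
    simp only [eval_add, eval_sub, eval_mul, eval_pow, hs, ht, hu, eval_zero]
    ring
  obtain ⟨E, F, hSE, hTEF, hUF⟩ :=
    exists_linear_factor_of_isCoprime h₀.monic.ne_zero h₀.coprime hform
  have hpt : ∀ {x y : K} (h : W.toAffine.Nonsingular x y), ∃ c : K, c ≠ 0 ∧
      ((n + 2) • Affine.Point.some x y h).xRep = c • ![E.eval x, F.eval x] := by
    intro x y h
    obtain ⟨k, e, f, hk, hx, hs, ht, hu⟩ := key h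
    refine ⟨k⁻¹, inv_ne_zero hk, ?_⟩
    rw [hSE, eval_mul] at hs
    rw [hTEF, eval_add, eval_mul, eval_mul] at ht
    rw [hUF, eval_mul] at hu
    have hEF : E.eval x = k * e ∧ F.eval x = k * f := by
      -- By coprimality `C` and `D` do not both vanish at `x`, so one of them can be cancelled.
      by_cases hC : C.eval x = 0
      · have hD : D.eval x ≠ 0 := by
          intro hD
          obtain ⟨u, v, huv⟩ := h₀.coprime
          simpa [hC, hD] using congrArg (Polynomial.eval x) huv
        rw [hC] at ht
        exact ⟨mul_left_cancel₀ hD (by linear_combination ht),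
          mul_left_cancel₀ hD (by linear_combination hu)⟩
      · have hE : E.eval x = k * e := mul_left_cancel₀ hC (by linear_combination hs)
        rw [hE] at ht
        exact ⟨hE, mul_left_cancel₀ hC (by linear_combination ht)⟩
    rw [hx, hEF.1, hEF.2]
    ext i; fin_cases i <;> simp [hk]
  have hNA : A.natDegree ≤ (n + 1) ^ 2 := h₁.natDegree.le
  have hNB : B.natDegree + 1 ≤ (n + 1) ^ 2 := by
    by_cases hB : B = 0
    · rw [hB, natDegree_zero, zero_add]
      exact Nat.one_le_pow _ _ n.succ_pos
    · exact (natDegree_lt_iff_degree_lt hB).mpr h₁.degree_lt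
  have hAX : (A * X).natDegree ≤ (n + 1) ^ 2 + 1 :=
    natDegree_mul_le_of_le hNA natDegree_X_le
  have hBX : (B * X).natDegree ≤ (n + 1) ^ 2 :=
    (natDegree_mul_le_of_le le_rfl natDegree_X_le).trans hNB
  have hABX : (A + B * X).natDegree ≤ (n + 1) ^ 2 := natDegree_add_le_of_degree_le hNA hBX
  have hC0 : ∀ c : K, (Polynomial.C c).natDegree ≤ 0 := fun c ↦ (natDegree_C c).le
  have hNB' : B.natDegree ≤ (n + 1) ^ 2 := by omega
  have hSrest : (Polynomial.C W.b₄ * (A * X) * B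
      + Polynomial.C W.b₆ * (A + B * X) * B + Polynomial.C W.b₈ * B ^ 2).natDegree
      ≤ 2 * (n + 1) ^ 2 + 1 := by
    refine natDegree_add_le_of_degree_le (natDegree_add_le_of_degree_le ?_ ?_) ?_
    · exact (natDegree_mul_le_of_le (natDegree_mul_le_of_le (hC0 _) hAX) hNB').trans (by omega)
    · exact (natDegree_mul_le_of_le (natDegree_mul_le_of_le (hC0 _) hABX) hNB').trans (by omega)
    · exact (natDegree_mul_le_of_le (hC0 _) (natDegree_pow_le_of_le 2 hNB')).trans (by omega)
  have hTdeg : T.natDegree ≤ 2 * (n + 1) ^ 2 + 1 := by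
    refine natDegree_add_le_of_degree_le (natDegree_add_le_of_degree_le
      (natDegree_add_le_of_degree_le ?_ ?_) ?_) ?_
    · exact (natDegree_mul_le_of_le (natDegree_mul_le_of_le (hC0 _) hABX) hAX).trans (by omega)
    · exact (natDegree_mul_le_of_le (natDegree_mul_le_of_le (hC0 _) hAX) hNB').trans (by omega)
    · exact (natDegree_mul_le_of_le (natDegree_mul_le_of_le (hC0 _) hABX) hNB').trans (by omega)
    · exact (natDegree_mul_le_of_le (hC0 _) (natDegree_pow_le_of_le 2 hNB')).trans (by omega)
  have hmain : ((A * X) ^ 2).Monic := (h₁.monic.mul monic_X).pow 2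
  have hmaindeg : ((A * X) ^ 2).natDegree = 2 * (n + 1) ^ 2 + 2 := by
    rw [(h₁.monic.mul monic_X).natDegree_pow, h₁.monic.natDegree_mul monic_X, h₁.natDegree,
      natDegree_X]
    ring
  have hlt : (Polynomial.C W.b₄ * (A * X) * B + Polynomial.C W.b₆ * (A + B * X) * B
      + Polynomial.C W.b₈ * B ^ 2).degree < ((A * X) ^ 2).degree := by
    rw [degree_eq_natDegree hmain.ne_zero, hmaindeg]
    exact degree_le_natDegree.trans_lt (Nat.cast_lt.mpr (by omega))
  have hSmonic : S.Monic := hmain.sub_of_left hlt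
  have hSdeg : S.natDegree = 2 * (n + 1) ^ 2 + 2 := by
    rw [hS, natDegree_sub_eq_left_of_natDegree_lt (by omega), hmaindeg]
  have hEmonic : E.Monic := h₀.monic.of_mul_monic_left (hSE ▸ hSmonic)
  have hEdeg : E.natDegree = (n + 2) ^ 2 := by
    rw [hSE, h₀.monic.natDegree_mul hEmonic, h₀.natDegree] at hSdeg
    nlinarith
  refine ⟨E, F, hEmonic, hEdeg, ?_, ?_, hpt⟩
  -- Here `n ^ 2 + (n + 2) ^ 2 = 2 * (n + 1) ^ 2 + 2`, one more than the bound on the degree of `T`.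
  · have hCF : C * F = T - D * E := by rw [hTEF]; ring
    have hdeg : (C * F).degree < ((n ^ 2 + (n + 2) ^ 2 : ℕ) : WithBot ℕ) := by
      rw [hCF]
      refine (degree_sub_le _ _).trans_lt (max_lt ?_ ?_)
      · exact degree_le_natDegree.trans_lt (Nat.cast_lt.mpr (by nlinarith))
      · rw [degree_mul, degree_eq_natDegree hEmonic.ne_zero, hEdeg, Nat.cast_add]
        exact WithBot.add_lt_add_right (WithBot.natCast_ne_bot _) h₀.degree_lt
    rw [degree_mul, degree_eq_natDegree h₀.monic.ne_zero, h₀.natDegree, Nat.cast_add] at hdeg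
    exact lt_of_add_lt_add_left hdeg
  · rw [Polynomial.isCoprime_iff_aeval_ne_zero_of_isAlgClosed K K]
    intro x
    obtain ⟨y, h⟩ := W.exists_nonsingular x
    obtain ⟨c, hc, hx⟩ := hpt h
    by_contra! h0
    rw [coe_aeval_eq_eval] at h0
    refine Affine.Point.xRep_ne_zero ((n + 2) • Affine.Point.some x y h) ?_
    rw [hx, h0.1, h0.2]
    ext i; fin_cases i <;> simp

variable (W) in
theorem exists_isMulByX [IsAlgClosed K] [W.IsElliptic] (n : ℕ) : ∃ A B, W.IsMulByX n A B := by
  have : (∃ A B, W.IsMulByX n A B) ∧ ∃ A B, W.IsMulByX (n + 1) A B := by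
    induction n with
    | zero => exact ⟨⟨1, 0, W.isMulByX_zero⟩, ⟨X, 1, W.isMulByX_one⟩⟩
    | succ n ih =>
      obtain ⟨⟨C, D, h₀⟩, ⟨A, B, h₁⟩⟩ := ih
      exact ⟨⟨A, B, h₁⟩, h₀.step h₁⟩
  exact this.1

end WeierstrassCurve

/-! ### Multiplication by `p` in the absence of `p`-torsion -/

namespace WeierstrassCurve

variable {K : Type*} [Field K] {W : WeierstrassCurve K}

theorem Affine.Point.xRep_eq_div_one {P : W.toAffine.Point} {c u b : K} (hc : c ≠ 0) (hb : b ≠ 0)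
    (h : P.xRep = c • ![u, b]) : P.xRep = ![u / b, 1] := by
  match P with
  | 0 => simpa [hc, hb] using congrFun h 1
  | some x y hP =>
    have h0 := congrFun h 0
    have h1 := congrFun h 1
    simp at h0 h1
    rw [xRep_some, h0]
    ext i; fin_cases i
    · simp only [Fin.zero_eta, Matrix.cons_val_zero]
      rw [eq_div_iff hb]
      linear_combination -u * h1
    · rfl

variable [DecidableEq K]

/-- If an elliptic curve over an algebraically closed field of characteristic `p` has no nontrivial
`p`-torsion, then multiplication by `p` acts on `x`-coordinates as the `p ^ 2`-power Frobenius, up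
to an affine transformation. -/
theorem exists_xRep_prime_smul [IsAlgClosed K] [W.IsElliptic] (p : ℕ) [Fact p.Prime] [CharP K p]
    (hW : ∀ P : W.toAffine.Point, p • P = 0 → P = 0) :
    ∃ a b : K, b ≠ 0 ∧ ∀ {x y : K} (h : W.toAffine.Nonsingular x y),
      (p • Affine.Point.some x y h).xRep = ![(x ^ p ^ 2 - a) / b, 1] := by
  obtain ⟨A, B, hAB⟩ := W.exists_isMulByX p
  -- A root of `B` would be the `x`-coordinate of a nontrivial `p`-torsion point; hence `B` is
  -- constant.
  have hB : ∀ x, B.eval x ≠ 0 := by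
    intro x hx
    obtain ⟨y, h⟩ := W.exists_nonsingular x
    obtain ⟨c, hc, hxr⟩ := hAB.exists_xRep h
    have h0 : p • Affine.Point.some x y h = 0 := by
      match hR : p • Affine.Point.some x y h with
      | 0 => rfl
      | .some x' y' h' => simpa [hR, hx] using congrFun hxr 1
    exact Affine.Point.some_ne_zero h (hW _ h0)
  have hBdeg : B.degree = 0 := by
    by_contra hne
    obtain ⟨x, hx⟩ := IsAlgClosed.exists_root B hne
    exact hB x hx
  rw [eq_C_of_degree_eq_zero hBdeg] at hAB hB
  set b := B.coeff 0
  have hb : b ≠ 0 := by simpa using hB 0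
  have hxRep : ∀ {x y : K} (h : W.toAffine.Nonsingular x y),
      (p • Affine.Point.some x y h).xRep = ![A.eval x / b, 1] := by
    intro x y h
    obtain ⟨c, hc, hxr⟩ := hAB.exists_xRep h
    rw [eval_C] at hxr
    exact Affine.Point.xRep_eq_div_one hc hb hxr
  have hp : p ^ 2 ≠ 0 := pow_ne_zero 2 (Fact.out : p.Prime).ne_zero
  obtain ⟨α, hα⟩ := IsAlgClosed.exists_root A (by
    rw [degree_eq_natDegree hAB.monic.ne_zero, hAB.natDegree]
    exact_mod_cast hp)
  -- `[p]` is injective, so points whose images share an `x`-coordinate agree up to sign: `A` has a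
  -- single root.
  have hroots : ∀ r ∈ A.roots, r = α := by
    intro r hr
    have hr : A.eval r = 0 := (mem_roots hAB.monic.ne_zero).mp hr
    obtain ⟨y, h⟩ := W.exists_nonsingular r
    obtain ⟨z, h'⟩ := W.exists_nonsingular α
    have e : (p • Affine.Point.some r y h).xRep = (p • Affine.Point.some α z h').xRep := by
      rw [hxRep, hxRep, hr, IsRoot.def.mp hα]
    have : Affine.Point.some r y h = Affine.Point.some α z h' ∨
        Affine.Point.some r y h = -Affine.Point.some α z h' := by
      rcases Affine.Point.xRep_eq_xRep_iff.mp e with e | e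
      · left
        rw [← sub_eq_zero]
        exact hW _ (by rw [smul_sub, e, sub_self])
      · right
        rw [← sub_eq_zero]
        exact hW _ (by rw [smul_sub, e, smul_neg, sub_self])
    exact Affine.Point.X_eq_iff.mpr this
  have hsplit := IsAlgClosed.splits A
  have hcard : A.roots.card = p ^ 2 := by
    rw [← hAB.natDegree, hsplit.natDegree_eq_card_roots]
  have hA : A = (X - C α) ^ p ^ 2 := by
    rw [hsplit.eq_prod_roots_of_monic hAB.monic,
      Multiset.eq_replicate.mpr ⟨hcard, hroots⟩, Multiset.map_replicate, Multiset.prod_replicate]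
  refine ⟨α ^ p ^ 2, b, hb, fun h ↦ ?_⟩
  rw [hxRep, hA, eval_pow, eval_sub, eval_X, eval_C, sub_pow_char_pow]

end WeierstrassCurve

/-! ### Torsion points on Legendre curves -/

section Legendre

open WeierstrassCurve WeierstrassCurve.Affine

variable {K : Type*} [Field K] {t : K}

theorem legendreCurve_Δ (t : K) : (legendreCurve t).Δ = 16 * t ^ 2 * (t - 1) ^ 2 := by
  simp only [WeierstrassCurve.Δ, b₂, b₄, b₆, b₈, legendreCurve]
  ring

theorem legendreCurve_ne_zero_and_ne_one [(legendreCurve t).IsElliptic] : t ≠ 0 ∧ t ≠ 1 := by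
  have h : (legendreCurve t).Δ ≠ 0 := (legendreCurve t).isUnit_Δ.ne_zero
  rw [legendreCurve_Δ] at h
  constructor <;> rintro rfl <;> simp at h

theorem legendreCurve_nonsingular [(legendreCurve t).IsElliptic] {x y : K}
    (h : y ^ 2 = x * (x - 1) * (x - t)) : (legendreCurve t).toAffine.Nonsingular x y :=
  equation_iff_nonsingular.mp ((legendreCurve_equation_iff t x y).mpr h)

theorem legendreCurve_negY (x y : K) : (legendreCurve t).toAffine.negY x y = -y := by
  simp [negY, legendreCurve]

variable [DecidableEq K]

theorem legendreCurve_two_nsmul_of_y_eq_zero {x y : K}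
    (h : (legendreCurve t).toAffine.Nonsingular x y) (hy : y = 0) : 2 • Point.some x y h = 0 := by
  rw [two_nsmul, Point.add_self_of_Y_eq]
  rw [legendreCurve_negY, hy, neg_zero]

/-- The duplication formula on a Legendre curve, for a point whose tangent has slope `m`. -/
theorem legendreCurve_two_nsmul (h2 : (2 : K) ≠ 0) {x y m : K}
    (h : (legendreCurve t).toAffine.Nonsingular x y) (hy : y ≠ 0)
    (hm : m * (2 * y) = 3 * x ^ 2 - 2 * (1 + t) * x + t) :
    ∃ y' h', 2 • Point.some x y h = Point.some (m ^ 2 + (1 + t) - 2 * x) y' h' := by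
  have hne : y ≠ (legendreCurve t).toAffine.negY x y := by
    rw [legendreCurve_negY]
    intro hyy
    exact mul_ne_zero h2 hy (by linear_combination hyy)
  have hs := slope_of_Y_ne (W := (legendreCurve t).toAffine) (rfl : x = x) hne
  have hsm : (legendreCurve t).toAffine.slope x x y y = m := by
    rw [hs, legendreCurve_negY, div_eq_iff (by rw [sub_neg_eq_add, ← two_mul]; exact mul_ne_zero h2 hy)]
    simp only [legendreCurve]
    linear_combination -hm
  have hx : (legendreCurve t).toAffine.addX x x ((legendreCurve t).toAffine.slope x x y y) =
      m ^ 2 + (1 + t) - 2 * x := by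
    rw [hsm, addX]
    simp only [legendreCurve]
    ring
  rw [two_nsmul, Point.add_self_of_Y_ne hne]
  simp only [Point.some.injEq]
  refine ⟨_, ?_, hx, rfl⟩
  rw [← hx]
  exact nonsingular_add h h fun hxy ↦ hne hxy.right

/-- A point of order four on a Legendre curve whose parameter is a square. -/
theorem legendreCurve_four_nsmul [(legendreCurve t).IsElliptic] (h2 : (2 : K) ≠ 0) {w i : K}
    (hw : w ^ 2 = t) (hi : i ^ 2 = -1)
    (h : (legendreCurve t).toAffine.Nonsingular w (i * w * (w - 1))) :
    2 • Point.some _ _ h ≠ 0 ∧ 4 • Point.some _ _ h = 0 := by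
  obtain ⟨ht0, ht1⟩ := legendreCurve_ne_zero_and_ne_one (t := t)
  have hw0 : w ≠ 0 := by rintro rfl; exact ht0 (by rw [← hw]; ring)
  have hw1 : w - 1 ≠ 0 := fun h ↦ ht1 (by rw [← hw]; linear_combination (w + 1) * h)
  have hi0 : i ≠ 0 := by rintro rfl; norm_num at hi
  obtain ⟨y', h', e⟩ := legendreCurve_two_nsmul (m := i * (w - 1)) h2 h
    (mul_ne_zero (mul_ne_zero hi0 hw0) hw1)
    (by rw [← hw]; linear_combination 2 * w * (w - 1) ^ 2 * hi)
  refine ⟨by rw [e]; exact Point.some_ne_zero h', ?_⟩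
  rw [show 4 = 2 * 2 from rfl, mul_smul, e]
  refine legendreCurve_two_nsmul_of_y_eq_zero h' ?_
  -- The double has `x = 0`, so it is the point `(0, 0)` of order two.
  have hx : (i * (w - 1)) ^ 2 + (1 + t) - 2 * w = 0 := by
    rw [← hw]; linear_combination (w - 1) ^ 2 * hi
  have := (legendreCurve_equation_iff t _ _).mp h'.left
  rw [hx] at this
  simpa using this

/-- A point of order three on a Legendre curve: the differences of its `x`-coordinate with those
of the points of order two are squares of `r₁`, `r₂`, `r₃` with `r₁ r₂ + r₁ r₃ + r₂ r₃ = 0`. -/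
theorem legendreCurve_three_nsmul (h2 : (2 : K) ≠ 0) {r₁ r₂ r₃ : K}
    (h₂ : r₁ ^ 2 - r₂ ^ 2 = 1) (h₃ : r₁ ^ 2 - r₃ ^ 2 = t)
    (hr : r₁ * r₂ + r₁ * r₃ + r₂ * r₃ = 0) (h0 : r₁ * r₂ * r₃ ≠ 0)
    (h : (legendreCurve t).toAffine.Nonsingular (r₁ ^ 2) (r₁ * r₂ * r₃)) :
    3 • Point.some _ _ h = 0 := by
  -- The derivative of the cubic at `r₁ ^ 2` is `∑ rᵢ² rⱼ²`, which `hr` turns into `-2 (r₁ + r₂ +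
  -- r₃) r₁ r₂ r₃`; as `y = r₁ r₂ r₃`, this gives the slope.
  obtain ⟨y', h', e⟩ := legendreCurve_two_nsmul (m := -(r₁ + r₂ + r₃)) h2 h h0 (by
    rw [← h₃, show (3 : K) * (r₁ ^ 2) ^ 2 - 2 * (1 + (r₁ ^ 2 - r₃ ^ 2)) * r₁ ^ 2
      + (r₁ ^ 2 - r₃ ^ 2) = 3 * (r₁ ^ 2) ^ 2 - 2 * ((r₁ ^ 2 - r₂ ^ 2) + (r₁ ^ 2 - r₃ ^ 2)) * r₁ ^ 2
      + (r₁ ^ 2 - r₂ ^ 2) * (r₁ ^ 2 - r₃ ^ 2) by rw [h₂]; ring]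
    linear_combination -(r₁ * r₂ + r₁ * r₃ + r₂ * r₃) * hr)
  have hx : (-(r₁ + r₂ + r₃)) ^ 2 + (1 + t) - 2 * r₁ ^ 2 = r₁ ^ 2 := by
    rw [← h₃, ← h₂]; linear_combination 2 * hr
  set P := Point.some _ _ h with hP
  have : 2 • P = P ∨ 2 • P = -P := by rw [e]; exact Point.X_eq_iff.mp hx
  rw [succ_nsmul]
  rcases this with hh | hh
  · rw [two_nsmul, add_eq_left] at hh
    exact absurd hh (Point.some_ne_zero h)
  · rw [hh, neg_add_cancel]

/-- On a Legendre curve without nontrivial `p`-torsion, multiplication by `p` is the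
`p ^ 2`-power Frobenius on `x`-coordinates. -/
theorem legendreCurve_xRep_prime_smul [IsAlgClosed K] [(legendreCurve t).IsElliptic] (p : ℕ)
    [Fact p.Prime] [CharP K p] (hp : Odd p)
    (hW : ∀ P : (legendreCurve t).toAffine.Point, p • P = 0 → P = 0) {x y : K}
    (h : (legendreCurve t).toAffine.Nonsingular x y) :
    (p • Point.some x y h).xRep = ![x ^ p ^ 2, 1] := by
  obtain ⟨a, b, hb, hab⟩ := exists_xRep_prime_smul p hW
  -- An odd multiple of a point of order two is the point itself.
  have htwo : ∀ {x : K} (h : (legendreCurve t).toAffine.Nonsingular x 0),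
      x = (x ^ p ^ 2 - a) / b := by
    intro x h
    obtain ⟨k, hk⟩ := hp
    have e : p • Point.some x 0 h = Point.some x 0 h := by
      rw [hk, succ_nsmul, mul_comm 2 k, mul_smul, legendreCurve_two_nsmul_of_y_eq_zero h rfl,
        smul_zero, zero_add]
    have := congrFun (hab h) 0
    rw [e] at this
    simpa using this
  have hp0 : p ^ 2 ≠ 0 := pow_ne_zero 2 (Fact.out : p.Prime).ne_zero
  have ha : a = 0 := by
    have := htwo (legendreCurve_nonsingular (t := t) (x := 0) (y := 0) (by ring))
    rw [zero_pow hp0, eq_div_iff hb] at this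
    linear_combination this
  have hb1 : b = 1 := by
    have := htwo (legendreCurve_nonsingular (t := t) (x := 1) (y := 0) (by ring))
    rw [one_pow, eq_div_iff hb, ha] at this
    linear_combination this
  rw [hab h, ha, hb1, sub_zero, div_one]

end Legendre

/-! ### Square roots in the fields of `p` and `p ^ 2` elements -/

open WeierstrassCurve WeierstrassCurve.Affine

/-- A primitive cube root of unity `g` exists, and `(2 * g + 1) ^ 2 = -3`. -/
theorem ZMod.exists_sq_eq_neg_three {p : ℕ} [Fact p.Prime] (hp : p % 3 = 1) :
    ∃ b : ZMod p, b ^ 2 = -3 := by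
  have : Fact (Nat.Prime 3) := ⟨Nat.prime_three⟩
  obtain ⟨g, hg⟩ := exists_prime_orderOf_dvd_card (G := (ZMod p)ˣ) 3
    (by rw [ZMod.card_units]; exact (Nat.modEq_iff_dvd' (Fact.out : p.Prime).one_le).mp hp.symm)
  have h3 : (g : ZMod p) ^ 3 = 1 := by
    rw [← Units.val_pow_eq_pow_val, ← hg, pow_orderOf_eq_one, Units.val_one]
  have h1 : (g : ZMod p) - 1 ≠ 0 := by
    intro h
    have : g = 1 := Units.ext (by rw [Units.val_one]; linear_combination h)
    rw [this, orderOf_one] at hg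
    norm_num at hg
  have h0 : (g : ZMod p) ^ 2 + g + 1 = 0 :=
    (mul_eq_zero.mp (show ((g : ZMod p) - 1) * (g ^ 2 + g + 1) = 0 by
      linear_combination h3)).resolve_left h1
  exact ⟨2 * g + 1, by linear_combination 4 * h0⟩

section Frobenius

variable {K : Type*} [Field K] {p : ℕ}

/-- A square root of an element fixed by the `p`-power Frobenius is fixed by its square. -/
theorem pow_sq_eq_self_of_sq_pow_eq (hp : Odd p) {z : K} (hz : (z ^ 2) ^ p = z ^ 2) :
    z ^ p ^ 2 = z := by
  rw [sq p, pow_mul]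
  rw [← pow_mul, mul_comm, pow_mul] at hz
  rcases sq_eq_sq_iff_eq_or_eq_neg.mp hz with h | h
  · rw [h, h]
  · rw [h, hp.neg_pow, h, neg_neg]

/-- If the product of `z ^ 2` and its Frobenius conjugate is the square of an element of the prime
field, then `z` is fixed by the square of the Frobenius. -/
theorem pow_sq_eq_self_of_sq_pow_mul_eq (hp : Odd p) {z b : K} (hz0 : z ≠ 0) (hb : b ^ p = b)
    (hz : (z ^ 2) ^ p * z ^ 2 = b ^ 2) : z ^ p ^ 2 = z := by
  have h : (z ^ p * z) ^ 2 = b ^ 2 := by rw [← hz]; ring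
  have hfix : (z ^ p * z) ^ p = z ^ p * z := by
    rcases sq_eq_sq_iff_eq_or_eq_neg.mp h with h | h
    · rw [h, hb]
    · rw [h, hp.neg_pow, hb]
  rw [mul_pow, ← pow_mul, ← sq, mul_comm (z ^ p) z] at hfix
  exact mul_right_cancel₀ (pow_ne_zero p hz0) hfix

variable (K p) in
/-- The subfield fixed by the `p ^ 2`-power Frobenius. -/
def frobeniusSqFixedField [Fact p.Prime] [CharP K p] : Subfield K :=
  (iterateFrobenius K p 2).eqLocusField (RingHom.id K)

theorem mem_frobeniusSqFixedField [Fact p.Prime] [CharP K p] {z : K} :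
    z ∈ frobeniusSqFixedField K p ↔ z ^ p ^ 2 = z := by
  rw [frobeniusSqFixedField, RingHom.mem_eqLocusField, iterateFrobenius_def, RingHom.id_apply]

end Frobenius

/-! ### The contradiction from points of orders three and four -/

/-- A Legendre curve without nontrivial `p`-torsion, `p ≡ 7 [MOD 12]`, cannot have both a point of
order three and a point of order four with coordinates in the field with `p ^ 2` elements. -/
theorem legendreCurve_false_of_torsion {K : Type*} [Field K] [DecidableEq K] [IsAlgClosed K]
    {p : ℕ} [Fact p.Prime] [CharP K p] (hp : p % 12 = 7) {t : K} [(legendreCurve t).IsElliptic]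
    (hW : ∀ P : (legendreCurve t).toAffine.Point, p • P = 0 → P = 0) {x₁ y₁ x₂ y₂ : K}
    (h₁ : (legendreCurve t).toAffine.Nonsingular x₁ y₁)
    (h₂ : (legendreCurve t).toAffine.Nonsingular x₂ y₂)
    (h3 : 3 • Point.some _ _ h₁ = 0) (h4 : 4 • Point.some _ _ h₂ = 0)
    (h4' : 2 • Point.some _ _ h₂ ≠ 0) (hx₁ : x₁ ∈ frobeniusSqFixedField K p)
    (hy₁ : y₁ ∈ frobeniusSqFixedField K p) (hx₂ : x₂ ∈ frobeniusSqFixedField K p)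
    (hy₂ : y₂ ∈ frobeniusSqFixedField K p) (ht : t ∈ frobeniusSqFixedField K p) : False := by
  have hodd : Odd p := Nat.odd_iff.mpr (by omega)
  set P := Point.some _ _ h₁ with hP
  set Q := Point.some _ _ h₂ with hQ
  have hP2 : 2 • P ≠ 0 := by
    intro h
    rw [succ_nsmul, h, zero_add] at h3
    exact Point.some_ne_zero h₁ h3
  have hpP : p • P = P := by
    rw [show p = (p / 3) * 3 + 1 by omega, succ_nsmul, mul_smul, h3, smul_zero, zero_add]
  have hpQ : p • Q = -Q := by
    rw [eq_neg_iff_add_eq_zero, ← succ_nsmul, show p + 1 = (p / 4 + 1) * 4 by omega, mul_smul, h4,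
      smul_zero]
  -- Otherwise `P = ±Q` is killed by both 3 and 4.
  have hx : x₁ ≠ x₂ := by
    intro hx
    have h : 4 • P = 0 := by
      rcases Point.X_eq_iff.mp hx with h | h
      · rw [hP, h]; exact h4
      · rw [hP, h, smul_neg, neg_eq_zero]; exact h4
    rw [succ_nsmul, h3, zero_add] at h
    exact Point.some_ne_zero h₁ h
  have hsum := Point.add_of_X_ne (h₁ := h₁) (h₂ := h₂) hx
  rw [← hP, ← hQ] at hsum
  have hfix : (legendreCurve t).toAffine.addX x₁ x₂ ((legendreCurve t).toAffine.slope x₁ x₂ y₁ y₂)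
      ∈ frobeniusSqFixedField K p := by
    rw [slope_of_X_ne hx, addX]
    have hm := div_mem (sub_mem hy₁ hy₂) (sub_mem hx₁ hx₂)
    have ha : -(1 + t) ∈ frobeniusSqFixedField K p := by
      exact neg_mem (add_mem (one_mem _) ht)
    exact sub_mem (sub_mem (sub_mem (add_mem (pow_mem hm 2) (mul_mem (zero_mem _) hm)) ha) hx₁) hx₂
  have hns := nonsingular_add h₁ h₂ fun hxy ↦ hx hxy.left
  have hxR := legendreCurve_xRep_prime_smul p hodd hW hns
  rw [← hsum, mem_frobeniusSqFixedField.mp hfix, smul_add, hpP, hpQ, ← Point.xRep_some hns,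
    ← hsum] at hxR
  rcases Point.xRep_eq_xRep_iff.mp hxR with h | h
  · apply h4'
    rw [two_nsmul]
    nth_rw 1 [← add_left_cancel h]
    exact neg_add_cancel Q
  · apply hP2
    rw [neg_add] at h
    rw [two_nsmul]
    nth_rw 1 [add_right_cancel h]
    exact neg_add_cancel P

/-- With `d = l + s`, the square roots `m`, `i`, `v` of `1 - l`, `-1`, `2 * d - 1` all lie in `F`,
and they suffice to write down points of orders 4 and 3. -/
theorem not_isSupersingular_legendreCurve_lambdaPlus {K : Type*} [Field K] [IsAlgClosed K]
    {p : ℕ} [Fact p.Prime] [CharP K p] (hp : p % 12 = 7) {l b s : K} (hl : l ^ p = l)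
    (hbp : b ^ p = b) (hb : b ^ 2 = -3) (hs : s ^ 2 = l ^ 2 - l + 1) :
    ¬ IsSupersingular p (legendreCurve (LambdaPlus l s)) := by
  classical
  rintro ⟨hE, hW⟩
  have hodd : Odd p := Nat.odd_iff.mpr (by omega)
  have hsp : (s ^ 2) ^ p = s ^ 2 := by
    rw [hs, add_pow_char, sub_pow_char, one_pow, ← pow_mul, mul_comm, pow_mul, hl]
  have hpp : (2 : K) ≠ 0 := by
    intro h
    have h2 : ((2 : ℕ) : K) = 0 := by exact_mod_cast h
    have := Nat.le_of_dvd two_pos ((CharP.cast_eq_zero_iff K p 2).mp h2)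
    omega
  have h2p : (2 : K) ^ p = 2 := map_ofNat (frobenius K p) 2
  obtain ⟨ht0, ht1⟩ := legendreCurve_ne_zero_and_ne_one (t := LambdaPlus l s)
  rw [LambdaPlus] at ht0
  have hd : l + s ≠ 0 := fun h ↦ ht0 (by rw [h]; ring)
  obtain ⟨m, hm⟩ := IsAlgClosed.exists_pow_nat_eq (1 - l) two_pos
  obtain ⟨i, hi⟩ := IsAlgClosed.exists_pow_nat_eq (-1 : K) two_pos
  obtain ⟨v, hv⟩ := IsAlgClosed.exists_pow_nat_eq (2 * (l + s) - 1) two_pos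
  have h3 : (3 : K) ≠ 0 := by
    intro h
    have h2 : ((3 : ℕ) : K) = 0 := by exact_mod_cast h
    have := (CharP.cast_eq_zero_iff K p 3).mp h2
    have := Nat.le_of_dvd three_pos this
    omega
  -- If Frobenius negates `s`, this product is `v ^ 2` times its conjugate; that `-3` is a square in
  -- the prime field then puts `v` in `F`.
  have hu : v ^ 2 * (2 * l - 1 - 2 * s) = -3 := by rw [hv]; linear_combination -4 * hs
  have hv0 : v ≠ 0 := by
    rintro rfl
    rw [zero_pow two_ne_zero, zero_mul] at hu
    exact h3 (neg_eq_zero.mp hu.symm)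
  set F := frobeniusSqFixedField K p
  have hF : ∀ z : K, z ∈ F ↔ z ^ p ^ 2 = z := fun z ↦ mem_frobeniusSqFixedField
  have hlF : l ∈ F := (hF l).mpr (by rw [sq p, pow_mul, hl, hl])
  have hsF : s ∈ F := (hF s).mpr (pow_sq_eq_self_of_sq_pow_eq hodd hsp)
  have hmF : m ∈ F := (hF m).mpr (pow_sq_eq_self_of_sq_pow_eq hodd (by
    rw [hm, sub_pow_char, one_pow, hl]))
  have hiF : i ∈ F := (hF i).mpr (pow_sq_eq_self_of_sq_pow_eq hodd (by
    rw [hi, hodd.neg_pow, one_pow]))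
  have hvF : v ∈ F := by
    rw [hF]
    have hvp : (v ^ 2) ^ p = 2 * (l + s ^ p) - 1 := by
      rw [hv, sub_pow_char, mul_pow, add_pow_char, h2p, hl, one_pow]
    rw [← pow_mul, mul_comm, pow_mul] at hsp
    rcases sq_eq_sq_iff_eq_or_eq_neg.mp hsp with h | h
    · exact pow_sq_eq_self_of_sq_pow_eq hodd (by rw [hvp, h, hv])
    · refine pow_sq_eq_self_of_sq_pow_mul_eq hodd hv0 hbp ?_
      rw [hvp, h, hb]
      linear_combination hu
  -- the point of order four
  have hw : (m * (l + s)) ^ 2 = LambdaPlus l s := by rw [mul_pow, hm, LambdaPlus]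
  have hQ : (legendreCurve (LambdaPlus l s)).toAffine.Nonsingular (m * (l + s))
      (i * (m * (l + s)) * (m * (l + s) - 1)) := by
    apply legendreCurve_nonsingular
    rw [← hw]
    linear_combination (m * (l + s)) ^ 2 * (m * (l + s) - 1) ^ 2 * hi
  obtain ⟨hQ2, hQ4⟩ := legendreCurve_four_nsmul hpp hw hi hQ
  -- the point of order three
  obtain ⟨r, hr⟩ : ∃ r, r = (l + s) / v := ⟨_, rfl⟩
  obtain ⟨c, hc⟩ : ∃ c, c = 1 / (l + s) - 1 := ⟨_, rfl⟩
  have hr0 : r ≠ 0 := by rw [hr]; exact div_ne_zero hd hv0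
  have hrv : r ^ 2 * (2 * (l + s) - 1) = (l + s) ^ 2 := by
    rw [← hv, hr, div_pow, div_mul_cancel₀ _ (pow_ne_zero 2 hv0)]
  have hcd : c * (l + s) = 1 - (l + s) := by rw [hc]; field_simp
  have hd2 : (l + s) ^ 2 ≠ 0 := pow_ne_zero 2 hd
  have hr₂ : r ^ 2 - (c * r) ^ 2 = 1 := by
    apply mul_left_cancel₀ hd2
    linear_combination hrv - r ^ 2 * (c * (l + s) + 1 - (l + s)) * hcd
  have hr₃ : r ^ 2 - (-(c * r * (l + s))) ^ 2 = LambdaPlus l s := by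
    rw [LambdaPlus]
    apply mul_left_cancel₀ (pow_ne_zero 2 hv0)
    rw [hv]
    linear_combination (1 - (1 - (l + s)) ^ 2) * hrv
      - (2 * (l + s) - 1) * r ^ 2 * (c * (l + s) + 1 - (l + s)) * hcd - (l + s) ^ 2 * hs
  have hr₀ : r * (c * r) + r * (-(c * r * (l + s))) + (c * r) * (-(c * r * (l + s))) = 0 := by
    linear_combination -c * r ^ 2 * hcd
  -- If `c = 0`, then `r₂ = r₃ = 0` and the Legendre parameter would be 1.
  have hc0 : c ≠ 0 := by
    intro h
    apply ht1
    rw [← hr₃, ← hr₂, h]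
    ring
  have hP : (legendreCurve (LambdaPlus l s)).toAffine.Nonsingular (r ^ 2)
      (r * (c * r) * (-(c * r * (l + s)))) := by
    apply legendreCurve_nonsingular
    rw [← hr₃]
    linear_combination -r ^ 2 * (c * r * (l + s)) ^ 2 * hr₂
  have hP3 := legendreCurve_three_nsmul hpp hr₂ hr₃ hr₀ (mul_ne_zero (mul_ne_zero hr0
    (mul_ne_zero hc0 hr0)) (neg_ne_zero.mpr (mul_ne_zero (mul_ne_zero hc0 hr0) hd))) hP
  have hdF : l + s ∈ F := add_mem hlF hsF
  have hrF : r ∈ F := hr ▸ div_mem hdF hvF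
  have hcF : c ∈ F := hc ▸ sub_mem (div_mem (one_mem F) hdF) (one_mem F)
  have hwF : m * (l + s) ∈ F := mul_mem hmF hdF
  have hcrF : c * r ∈ F := mul_mem hcF hrF
  refine legendreCurve_false_of_torsion hp (fun P h ↦ hW P (by convert h)) hP hQ hP3 hQ4 hQ2
    (pow_mem hrF 2) (mul_mem (mul_mem hrF hcrF) (neg_mem (mul_mem hcrF hdF))) hwF
    (mul_mem (mul_mem hiF hwF) (sub_mem hwF (one_mem F))) (hw ▸ pow_mem hwF 2)

theorem corollary4p6 (p : ℕ) [Fact p.Prime] (hp : p ≡ 7 [MOD 12]) :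
    ¬ ∃ (l : ZMod p) (s : AlgebraicClosure (ZMod p)),
      s ^ 2 = algebraMap (ZMod p) (AlgebraicClosure (ZMod p)) (l ^ 2 - l + 1) ∧
      IsSupersingular p (legendreCurve
        (LambdaMinus (algebraMap (ZMod p) (AlgebraicClosure (ZMod p)) l) s)) ∧
      IsSupersingular p (legendreCurve
        (LambdaPlus (algebraMap (ZMod p) (AlgebraicClosure (ZMod p)) l) s)) := by
  rintro ⟨l, s, hs, -, h⟩
  have hp12 : p % 12 = 7 := hp
  obtain ⟨b, hb⟩ := ZMod.exists_sq_eq_neg_three (p := p) (by omega)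
  refine not_isSupersingular_legendreCurve_lambdaPlus hp12
    (b := algebraMap (ZMod p) (AlgebraicClosure (ZMod p)) b) ?_ ?_ ?_ ?_ h
  · rw [← map_pow, ZMod.pow_card]
  · rw [← map_pow, ZMod.pow_card]
  · rw [← map_pow, hb, map_neg, map_ofNat]
  · rw [hs, map_add, map_sub, map_pow, map_one]
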